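/- **Theorem.** Let $B_3=\langle\sigma_1,\sigma_2\mid\sigma_1\sigma_2\sigma_1=\sigma_2\sigma_1\sigma_2\rangle$ be the 3-strand braid group, let $\Delta=\sigma_1\sigma_2\sigma_1$, and let $\psi\colon B_3\to SL_2(\mathbb Z)$, $\beta\mapsto\widehat\beta$, be the homomorphism with $$\widehat{\sigma_1}=\begin{pmatrix}1&1\\0&1\end{pmatrix},\qquad \widehat{\sigma_2}=\begin{pmatrix}1&0\\-1&1\end{pmatrix}.$$ Call $\beta$ reducible if $|\mathrm{tr}\,\widehat\beta|=2$. Let $\beta\neq 1$ be a reducible 3-braid, written as $\beta=\Delta^{2k}\tau\sigma_1^m\tau^{-1}$ with $k,m\in\mathbb Z$ and $\tau\in B_3$. Then $|m|$ is the greatest common divisor of the two off-diagonal entries of $\widehat\beta$ (with $\gcd(0,0)=0$). Moreover: * if $1$ is an eigenvalue of $\widehat\beta$, then the sign of $m$ is the sign of the $(1,2)$-entry of $\widehat\beta$ if that entry is nonzero, and is the opposite of the sign of the $(2,1)$-entry if the $(1,2)$-entry is zero; * if $-1$ is an eigenvalue of $\widehat\beta$, then the sign of $m$ is the sign of the $(2,1)$-entry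 of $\widehat\beta$ if that entry is nonzero, and is the opposite of the sign of the $(1,2)$-entry if the $(2,1)$-entry is zero. Here the sign of an integer is $-1$, $0$ or $1$. -/

import Mathlib

/-- The braid relator `σ₁σ₂σ₁ (σ₂σ₁σ₂)⁻¹` in the free group on the two generators
`σ₁ = of 0`, `σ₂ = of 1`. -/
def braidRels : Set (FreeGroup (Fin 2)) :=
  {FreeGroup.of 0 * FreeGroup.of 1 * FreeGroup.of 0 *
    (FreeGroup.of 1 * FreeGroup.of 0 * FreeGroup.of 1)⁻¹}

/-- The 3-strand braid group `B₃ = ⟨σ₁, σ₂ | σ₁σ₂σ₁ = σ₂σ₁σ₂⟩`. -/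
abbrev B3 : Type := PresentedGroup braidRels

/-- The generator `σ₁` of `B₃`. -/
def σ₁ : B3 := PresentedGroup.of 0

/-- The generator `σ₂` of `B₃`. -/
def σ₂ : B3 := PresentedGroup.of 1

/-- The half twist `Δ = (σ₁σ₂)σ₁`, whose square generates the centre of `B₃`. -/
def Δ : B3 := σ₁ * σ₂ * σ₁

/-- Images of the generators in `SL₂(ℤ)`: the actions on `H₁` of the torus of the positive Dehn
twists about two dual curves. -/
def psiGen : Fin 2 → Matrix.SpecialLinearGroup (Fin 2) ℤ :=
  ![⟨!![1, 1; 0, 1], by simp [Matrix.det_fin_two]⟩,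
    ⟨!![1, 0; -1, 1], by simp [Matrix.det_fin_two]⟩]

theorem psiGen_rels : ∀ r ∈ braidRels, FreeGroup.lift psiGen r = 1 := by
  intro r hr
  rw [braidRels, Set.mem_singleton_iff] at hr
  subst hr
  simp only [map_mul, map_inv, FreeGroup.lift_apply_of, mul_inv_eq_one]
  decide

/-- The surjection `ψ : B₃ → SL₂(ℤ)`, `σ₁ ↦ (1 1; 0 1)`, `σ₂ ↦ (1 0; -1 1)`. It is the
specialization at `t = -1` of the reduced Burau representation
`σ₁ ↦ (-t -t; 0 1)`, `σ₂ ↦ (1 0; -1 -t)`. The image of `β` is written `β̂`. -/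
def psi : B3 →* Matrix.SpecialLinearGroup (Fin 2) ℤ :=
  PresentedGroup.toGroup psiGen_rels

/-- The matrix `β̂ = ψ(β)`. -/
def hatMatrix (β : B3) : Matrix (Fin 2) (Fin 2) ℤ := (psi β : Matrix (Fin 2) (Fin 2) ℤ)

/-- A 3-braid `β` is reducible if `|tr β̂| = 2`. -/
def IsReducibleBraid (β : B3) : Prop := |(hatMatrix β).trace| = 2

/-! Since `ψ(Δ²) = -1`, `β̂` is `(-1)^k` times a conjugate of `(1 m; 0 1)`, whose off-diagonal
entries are `m a²` and `-m c²` for the coprime first column `(a, c)` of the conjugator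
(`psi_conj_zpow`). Coprimality gives the gcd, and squares preserve the sign of `m`. The eigenvalue
fixes the trace, hence the parity of `k`. -/

theorem psi_σ₁_zpow (m : ℤ) :
    (psi σ₁ ^ m : Matrix.SpecialLinearGroup (Fin 2) ℤ).1 = !![1, m; 0, 1] := by
  have h : psi σ₁ = ModularGroup.T := by
    apply Subtype.ext
    simp [psi, σ₁, psiGen, ModularGroup.T]
  rw [h]
  exact ModularGroup.coe_T_zpow m

theorem psi_Δ_sq : psi Δ ^ 2 = -1 := by
  have h : psi Δ = psiGen 0 * psiGen 1 * psiGen 0 := by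
    simp [psi, Δ, σ₁, σ₂]
  rw [h]
  decide

/-- A conjugate of `(1 m; 0 1)` in `SL₂(ℤ)`, in terms of the first column of the conjugator. -/
theorem psi_conj_zpow (τ : B3) (m : ℤ) :
    ∃ a c : ℤ, IsCoprime a c ∧ (psi (τ * σ₁ ^ m * τ⁻¹)).1 =
      !![1 - m * (a * c), m * a ^ 2; -(m * c ^ 2), 1 + m * (a * c)] := by
  have hdet := (psi τ).det_coe
  rw [Matrix.det_fin_two] at hdet
  refine ⟨(psi τ).1 0 0, (psi τ).1 1 0, ⟨(psi τ).1 1 1, -(psi τ).1 0 1, by linarith⟩, ?_⟩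
  rw [map_mul, map_mul, map_inv, map_zpow, Matrix.SpecialLinearGroup.coe_mul,
    Matrix.SpecialLinearGroup.coe_mul, psi_σ₁_zpow, Matrix.SpecialLinearGroup.coe_inv,
    Matrix.adjugate_fin_two]
  ext i j
  fin_cases i <;> fin_cases j <;> simp [Matrix.mul_apply, Fin.sum_univ_two] <;>
    first | ring1 | linear_combination hdet

/-- The trace of an integral `2 × 2` matrix of determinant one with eigenvalue `μ = ±1`. -/
theorem trace_eq_of_hasEigenvalue {M : Matrix (Fin 2) (Fin 2) ℤ} (hM : M.det = 1) {μ : ℤ}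
    (hμ : μ ^ 2 = 1) (h : Module.End.HasEigenvalue (Matrix.toLin' M) μ) :
    M.trace = 2 * μ := by
  obtain ⟨v, hv⟩ := h.exists_hasEigenvector
  have he := hv.apply_eq_smul
  have h0 := congrFun he 0
  have h1 := congrFun he 1
  simp only [Matrix.toLin'_apply, Matrix.mulVec, dotProduct, Fin.sum_univ_two, Pi.smul_apply,
    smul_eq_mul] at h0 h1
  rw [Matrix.det_fin_two] at hM
  rw [Matrix.trace_fin_two]
  -- Applying the adjugate of `M - μ` to `(M - μ)v = 0` gives `det(M - μ) v = 0`, where `det(M - μ)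
  -- = 2 - μ tr M`; then multiply by `μ`.
  have key : ∀ i, (2 * μ - (M 0 0 + M 1 1)) * v i = 0 := by
    intro i
    fin_cases i
    · simp only [Fin.zero_eta]
      linear_combination μ * ((M 1 1 - μ) * h0 - M 0 1 * h1) - μ * v 0 * hM +
        (M 0 0 + M 1 1 - μ) * v 0 * hμ
    · simp only [Fin.mk_one]
      linear_combination μ * ((M 0 0 - μ) * h1 - M 1 0 * h0) - μ * v 1 * hM +
        (M 0 0 + M 1 1 - μ) * v 1 * hμ
  by_contra hne
  refine hv.2 (funext fun i => ?_)
  exact (mul_eq_zero.mp (key i)).resolve_left fun h => hne (by linarith)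

theorem gcd_mul_sq_mul_sq {a c : ℤ} (h : IsCoprime a c) (m : ℤ) :
    (Int.gcd (m * a ^ 2) (m * c ^ 2) : ℤ) = |m| := by
  rw [Int.gcd_mul_left, Int.isCoprime_iff_gcd_eq_one.mp h.pow, mul_one, Int.abs_eq_natAbs]

theorem sign_mul_sq {a : ℤ} (m : ℤ) (ha : a ≠ 0) : (m * a ^ 2).sign = m.sign := by
  rw [Int.sign_mul, Int.sign_eq_one_of_pos (by positivity : 0 < a ^ 2), mul_one]

/-- If `m ≠ 0` and `a = 0`, coprimality forces `c ≠ 0`, so the other entry still carries the sign.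
-/
theorem sign_eq_of_mul_sq {a c : ℤ} (h : IsCoprime a c) (m : ℤ) :
    (m * a ^ 2 ≠ 0 → m.sign = (m * a ^ 2).sign) ∧
    (m * a ^ 2 = 0 → m.sign = (m * c ^ 2).sign) := by
  refine ⟨fun h0 => (sign_mul_sq m fun ha => h0 (by simp [ha])).symm, fun h0 => ?_⟩
  rcases mul_eq_zero.mp h0 with rfl | ha
  · simp
  · have ha : a = 0 := by simpa using ha
    subst ha
    exact (sign_mul_sq m (h.ne_zero_or_ne_zero.resolve_left (by simp))).symm

theorem mainTheorem6 (β τ : B3) (k m : ℤ)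
    (hβ : β = Δ ^ (2 * k) * τ * σ₁ ^ m * τ⁻¹)
    (hred : IsReducibleBraid β) (hne : β ≠ 1) :
    |m| = (Int.gcd (hatMatrix β 0 1) (hatMatrix β 1 0) : ℤ) ∧
    (Module.End.HasEigenvalue (Matrix.toLin' (hatMatrix β)) 1 →
      (hatMatrix β 0 1 ≠ 0 → m.sign = (hatMatrix β 0 1).sign) ∧
      (hatMatrix β 0 1 = 0 → m.sign = -(hatMatrix β 1 0).sign)) ∧
    (Module.End.HasEigenvalue (Matrix.toLin' (hatMatrix β)) (-1) →
      (hatMatrix β 1 0 ≠ 0 → m.sign = (hatMatrix β 1 0).sign) ∧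
      (hatMatrix β 1 0 = 0 → m.sign = -(hatMatrix β 0 1).sign)) := by
  have hdet : (hatMatrix β).det = 1 := (psi β).det_coe
  have htr1 := trace_eq_of_hasEigenvalue hdet (μ := 1) (by norm_num)
  have htr2 := trace_eq_of_hasEigenvalue hdet (μ := -1) (by norm_num)
  obtain ⟨a, c, hac, hM⟩ := psi_conj_zpow τ m
  have hψ : psi β = (-1) ^ k * psi (τ * σ₁ ^ m * τ⁻¹) := by
    rw [hβ, mul_assoc, mul_assoc, ← mul_assoc τ, map_mul, map_zpow, zpow_mul, zpow_ofNat,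
      psi_Δ_sq]
  rw [Matrix.trace_fin_two] at htr1 htr2
  have hA := sign_eq_of_mul_sq hac m
  have hC := sign_eq_of_mul_sq hac.symm m
  have hg := (gcd_mul_sq_mul_sq hac m).symm
  rcases Int.even_or_odd k with hk | hk
  · have hN : hatMatrix β = !![1 - m * (a * c), m * a ^ 2; -(m * c ^ 2), 1 + m * (a * c)] := by
      rw [← hM, hatMatrix, hψ, hk.neg_one_zpow, one_mul]
    simp only [hN, Matrix.of_apply, Matrix.cons_val', Matrix.cons_val_zero, Matrix.cons_val_one,
      Matrix.cons_val_fin_one] at htr1 htr2 ⊢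
    -- For even `k` the trace is `2`, while eigenvalue `-1` would force `-2`.
    refine ⟨by rwa [Int.gcd_neg], fun _ => by rwa [Int.sign_neg, neg_neg], fun h => ?_⟩
    have := htr2 h
    omega
  · have hN : hatMatrix β =
        !![-(1 - m * (a * c)), -(m * a ^ 2); m * c ^ 2, -(1 + m * (a * c))] := by
      have hneg : hatMatrix β = -(psi (τ * σ₁ ^ m * τ⁻¹)).1 := by
        rw [hatMatrix, hψ, hk.neg_one_zpow, neg_one_mul, Matrix.SpecialLinearGroup.coe_neg]
      rw [hneg, hM]
      ext i j
      fin_cases i <;> fin_cases j <;> simp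
    simp only [hN, Matrix.of_apply, Matrix.cons_val', Matrix.cons_val_zero, Matrix.cons_val_one,
      Matrix.cons_val_fin_one] at htr1 htr2 ⊢
    refine ⟨by rwa [Int.neg_gcd], fun h => ?_, fun _ => by rwa [Int.sign_neg, neg_neg]⟩
    have := htr1 h
    omega
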